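/- All structures are relational with countable (possibly finite) domain. A structure $\mathbb A$ is *$\omega$-categorical* if $\mathrm{Aut}(\mathbb A)$ has only finitely many orbits on $n$-tuples for every $n\ge 1$; it is *homogeneous* if every isomorphism between finite induced substructures of $\mathbb A$ extends to an automorphism of $\mathbb A$. It is *Ramsey* if for all finite structures $\mathbb S,\mathbb F$ that embed into $\mathbb A$ and every colouring $\chi$ of the embeddings $\mathbb S\to\mathbb A$ with two colours there is an embedding $e\colon\mathbb F\to\mathbb A$ such that $\chi(e\circ h)$ is the same for all embeddings $h\colon\mathbb S\to\mathbb F$. An *expansion* of $\mathbb A$ is a structure on the same domain obtained by adding relations (with new relation symbols) to $\mathbb A$. An $\omega$-categorical structure is *model-complete* if its automorphisms are dense in its self-embeddings in the topology of pointwise convergence. A *model-companion* of $\mathbb A$ is a model-complete ($\omega$-categorical) structure $\mathbb A'$ in the same signature such that $\mathbb A$ embeds into $\mathbb A'$ and $\mathbb A'$ embeds into $\mathbb A$ (it is unique up to isomorphism). **Theorem.** Let $\mathbb A$ be an $\omega$-categorical structure. 1. If $\mathbb A$ has an $\omega$-categorical homogeneous Ramsey expansion, then $\mathbb A$ has a model-companion,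 and every model-companion of $\mathbb A$ has an $\omega$-categorical homogeneous Ramsey expansion. 2. If $\mathbb A$ has a homogeneous Ramsey expansion with a finite signature, then $\mathbb A$ has a model-companion, and every model-companion of $\mathbb A$ has a homogeneous Ramsey expansion with a finite signature. -/

import Mathlib

open FirstOrder

universe u v u' v' w w'

namespace FirstOrder.Language

/-- Two `n`-tuples lie in the same orbit of the componentwise action of the automorphism
group of `A`. -/
def orbitSetoid (L : Language.{u, v}) (A : Type w) [L.Structure A] (n : ℕ) :
    Setoid (Fin n → A) where
  r a b := ∃ α : A ≃[L] A, ∀ i, α (a i) = b i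
  iseqv :=
    { refl := fun _ => ⟨Equiv.refl L A, fun _ => rfl⟩
      symm := fun ⟨α, h⟩ => ⟨α.symm, fun i => by rw [← h i, α.symm_apply_apply]⟩
      trans := fun ⟨α, h⟩ ⟨β, k⟩ => ⟨β.comp α, fun i => by rw [Equiv.comp_apply, h i, k i]⟩ }

/-- `A` is ω-categorical: its automorphism group is oligomorphic, that is, it has only finitely
many orbits of `n`-tuples for every `n ≥ 1`. (Domains of structures are countable; countability
is a separate hypothesis wherever this is used.) -/
def IsOmegaCategorical (L : Language.{u, v}) (A : Type w) [L.Structure A] : Prop :=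
  ∀ n : ℕ, 1 ≤ n → Finite (Quotient (L.orbitSetoid A n))

/-- `A` is Ramsey: for all `S`, `F` in the age of `A` and every colouring of the copies of `S` in
`A` (that is, of the embeddings of `S` into `A`) with two colours there is a copy of `F` in `A`
on which the colouring is constant. For a relational language the age consists of the finite
structures that embed into `A`. -/
def IsRamsey (L : Language.{u, v}) (A : Type w) [L.Structure A] : Prop :=
  ∀ S ∈ L.age A, ∀ F ∈ L.age A, ∀ χ : (S ↪[L] A) → Bool,
    ∃ e : F ↪[L] A, ∃ c : Bool, ∀ h : S ↪[L] F, χ (e.comp h) = c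

/-- `A` is model-complete: it is countable and ω-categorical, and its automorphisms are dense in
its self-embeddings in the topology of pointwise convergence. -/
structure IsModelComplete (L : Language.{u, v}) (A : Type w) [L.Structure A] : Prop where
  countable : Countable A
  isOmegaCategorical : L.IsOmegaCategorical A
  dense : ∀ (e : A ↪[L] A) (s : Finset A), ∃ α : A ≃[L] A, ∀ x ∈ s, α x = e x

/-- `A'` is a model-companion of `A`: it is model-complete, and `A` and `A'` embed into each
other. -/
structure IsModelCompanion (L : Language.{u, v}) (A' : Type w') [L.Structure A']
    (A : Type w) [L.Structure A] : Prop where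
  isModelComplete : L.IsModelComplete A'
  embeds_into : Nonempty (A ↪[L] A')
  embeds_from : Nonempty (A' ↪[L] A)

/-- `A` has an ω-categorical homogeneous Ramsey expansion: one can add relations, named by the
symbols of a further relational language `L'`, so that the resulting structure in the language
`L.sum L'` is ω-categorical, homogeneous and Ramsey. -/
def HasOmegaCategoricalHomogeneousRamseyExpansion (L : Language.{u, v}) (A : Type w)
    [L.Structure A] : Prop :=
  ∃ (L' : Language.{u', v'}) (_ : L'.IsRelational) (_ : L'.Structure A),
    (L.sum L').IsOmegaCategorical A ∧ (L.sum L').IsUltrahomogeneous A ∧ (L.sum L').IsRamsey A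

/-- `A` has a homogeneous Ramsey expansion with a finite signature. The signature of the expansion
is `L.sum L'`; it contains the symbols of `L`. -/
def HasFiniteSignatureHomogeneousRamseyExpansion (L : Language.{u, v}) (A : Type w)
    [L.Structure A] : Prop :=
  ∃ (L' : Language.{u', v'}) (_ : L'.IsRelational) (_ : L'.Structure A),
    Finite (L.sum L').Symbols ∧ (L.sum L').IsUltrahomogeneous A ∧ (L.sum L').IsRamsey A

end FirstOrder.Language

/-! Let `G` be the automorphism group of the expansion and `E` the monoid of self-embeddings of the
original structure; `E` contains `G` and is closed under pointwise limits. The model-companion is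
what remains of the structure after a self-embedding that loses as much as possible. Since `G` is
oligomorphic, on each finite set some member of `E` leaves nothing further to lose
(`exists_recoverable_image`), and an ultralimit does this for all finite sets at once. The Ramsey
property makes the map canonical, so that it acts on the orbits of `G`; a limit of its factorial
iterates acts idempotently, that is, it preserves the orbits of tuples in its range
(`exists_canonical_rangeRigid`).

For such a map `f` the orbits of tuples in its range amalgamate, with `f` itself as the amalgamating
map, so they have a homogeneous limit `D` inside `A` (`exists_isHomogeneousLimit`). Up to `G`, `f`
factors locally through a map `j` into `D`. Pulling colourings back along `j` makes `D` Ramsey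
(`ramsey_locallyInduced`). Because nothing more can be lost, embeddings of `D` in the original
signature can be undone on finite sets, and back-and-forth turns this into model-completeness.

Model-companions are unique, so the expansion of `D` transfers to each of them. The added signature
never changes, and homogeneity in a finite signature implies oligomorphicity; hence one construction
gives both parts. -/

namespace OrbitAgreement

/-! ### Generic sets, forth, and back-and-forth -/

/-- A form of the Rasiowa–Sikorski lemma for a property `P` of finite sets. -/
theorem exists_generic_set {Z ι : Type*} [Countable ι] (P : Set Z → Prop) (C : ι → Set Z → Prop)
    (p₀ : Set Z) (hfin : p₀.Finite) (hP : P p₀)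
    (hC : ∀ i p, p.Finite → P p → ∃ q, p ⊆ q ∧ q.Finite ∧ P q ∧ C i q) :
    ∃ D : Set Z, p₀ ⊆ D ∧ (∀ T ⊆ D, T.Finite → ∃ q ⊆ D, T ⊆ q ∧ P q) ∧
      ∀ i, ∃ q ⊆ D, q.Finite ∧ C i q := by
  classical
  have := Encodable.ofCountable ι
  let Q := {p : Set Z // p.Finite ∧ P p}
  let 𝒟 : ι → Order.Cofinal Q := fun i =>
    ⟨{q | C i q.1}, fun p => by
      obtain ⟨q, h1, h2, h3, h4⟩ := hC i p.1 p.2.1 p.2.2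
      exact ⟨⟨q, h2, h3⟩, h4, h1⟩⟩
  let I := Order.idealOfCofinals (⟨p₀, hfin, hP⟩ : Q) 𝒟
  have h0 : (⟨p₀, hfin, hP⟩ : Q) ∈ I := Order.mem_idealOfCofinals _ _
  have hsub : ∀ q ∈ I, q.1 ⊆ ⋃ q ∈ I, q.1 := fun q hq z hz =>
    Set.mem_iUnion₂.2 ⟨q, hq, hz⟩
  refine ⟨⋃ q ∈ I, q.1, hsub _ h0, fun T hT hTf => ?_, fun i => ?_⟩
  · induction T, hTf using Set.Finite.induction_on with
    | empty => exact ⟨p₀, hsub _ h0, Set.empty_subset _, hP⟩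
    | @insert a s ha hs ih =>
      have h1 : ∃ q ∈ I, s ⊆ q.1 := by
        clear ih
        have hs' : s ⊆ ⋃ q ∈ I, q.1 := (Set.subset_insert _ _).trans hT
        clear hT ha
        induction s, hs using Set.Finite.induction_on with
        | empty => exact ⟨_, h0, Set.empty_subset _⟩
        | @insert b s hb hs ih =>
          obtain ⟨q, hq, hsq⟩ := ih ((Set.subset_insert _ _).trans hs')
          obtain ⟨r, hr, hbr⟩ := Set.mem_iUnion₂.1 (hs' (Set.mem_insert _ _))
          obtain ⟨t, ht, hqt, hrt⟩ := I.directed q hq r hr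
          exact ⟨t, ht, Set.insert_subset (hrt hbr) (hsq.trans hqt)⟩
      obtain ⟨q, hq, hsq⟩ := h1
      obtain ⟨r, hr, har⟩ := Set.mem_iUnion₂.1 (hT (Set.mem_insert _ _))
      obtain ⟨t, ht, hqt, hrt⟩ := I.directed q hq r hr
      exact ⟨t.1, hsub _ ht, Set.insert_subset (hrt har) (hsq.trans hqt), t.2.2⟩
  · obtain ⟨q, hq, hqI⟩ := Order.cofinal_meets_idealOfCofinals (⟨p₀, hfin, hP⟩ : Q) 𝒟 i
    exact ⟨q.1, hsub _ hqI, q.2.1, hq⟩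

/-- `P` need not force single-valuedness: the generic relation may be multivalued, and any selection
from it will do. -/
theorem exists_function_of_forth {X Y : Type*} [Countable X] (P : Set (X × Y) → Prop)
    (mono : ∀ p q, q ⊆ p → P p → P q)
    (forth : ∀ p, p.Finite → P p → ∀ x, ∃ y, P (insert (x, y) p))
    (h0 : P ∅) :
    ∃ g : X → Y, ∀ T : Set X, T.Finite → P ((fun x => (x, g x)) '' T) := by
  obtain ⟨D, -, hD, hC⟩ := exists_generic_set P (fun (x : X) q => ∃ y, (x, y) ∈ q) ∅
    Set.finite_empty h0 (fun x p hp hP => by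
      obtain ⟨y, hy⟩ := forth p hp hP x
      exact ⟨_, Set.subset_insert _ _, hp.insert _, hy, y, Set.mem_insert _ _⟩)
  have hg : ∀ x, ∃ y, (x, y) ∈ D := fun x => by
    obtain ⟨q, hq, -, y, hy⟩ := hC x
    exact ⟨y, hq hy⟩
  choose g hg using hg
  refine ⟨g, fun T hT => ?_⟩
  obtain ⟨q, -, hTq, hq⟩ := hD ((fun x => (x, g x)) '' T)
    (by rintro _ ⟨x, -, rfl⟩; exact hg x) (hT.image _)
  exact mono _ _ hTq hq

theorem exists_equiv_of_back_and_forth {X Y : Type*} [Countable X] [Countable Y]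
    (P : Set (X × Y) → Prop)
    (mono : ∀ p q, q ⊆ p → P p → P q)
    (single : ∀ p, P p → ∀ x y y', (x, y) ∈ p → (x, y') ∈ p → y = y')
    (inj : ∀ p, P p → ∀ x x' y, (x, y) ∈ p → (x', y) ∈ p → x = x')
    (forth : ∀ p, p.Finite → P p → ∀ x, ∃ y, P (insert (x, y) p))
    (back : ∀ p, p.Finite → P p → ∀ y, ∃ x, P (insert (x, y) p))
    (p₀ : Set (X × Y)) (hfin : p₀.Finite) (h0 : P p₀) :
    ∃ e : X ≃ Y, (∀ z ∈ p₀, e z.1 = z.2) ∧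
      ∀ T : Set X, T.Finite → P ((fun x => (x, e x)) '' T) := by
  obtain ⟨D, hp₀, hD, hC⟩ := exists_generic_set P
    (fun (i : X ⊕ Y) q => Sum.elim (fun x => ∃ y, (x, y) ∈ q) (fun y => ∃ x, (x, y) ∈ q) i) p₀
    hfin h0 (fun i p hp hP => by
      rcases i with x | y
      · obtain ⟨y, hy⟩ := forth p hp hP x
        exact ⟨_, Set.subset_insert _ _, hp.insert _, hy, y, Set.mem_insert _ _⟩
      · obtain ⟨x, hx⟩ := back p hp hP y
        exact ⟨_, Set.subset_insert _ _, hp.insert _, hx, x, Set.mem_insert _ _⟩)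
  have hg : ∀ x, ∃ y, (x, y) ∈ D := fun x => by
    obtain ⟨q, hq, -, y, hy⟩ := hC (.inl x)
    exact ⟨y, hq hy⟩
  have hh : ∀ y, ∃ x, (x, y) ∈ D := fun y => by
    obtain ⟨q, hq, -, x, hx⟩ := hC (.inr y)
    exact ⟨x, hq hx⟩
  choose g hg using hg
  choose h hh using hh
  have hpair : ∀ a ∈ D, ∀ b ∈ D, ∃ q, a ∈ q ∧ b ∈ q ∧ P q := fun a ha b hb => by
    obtain ⟨q, -, hq, hPq⟩ := hD {a, b} (by
      rintro _ (rfl | rfl)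
      exacts [ha, hb]) (by simp)
    exact ⟨q, hq (by simp), hq (by simp), hPq⟩
  have hs : ∀ x y y', (x, y) ∈ D → (x, y') ∈ D → y = y' := fun x y y' h1 h2 => by
    obtain ⟨q, ha, hb, hq⟩ := hpair _ h1 _ h2
    exact single q hq _ _ _ ha hb
  have hi : ∀ x x' y, (x, y) ∈ D → (x', y) ∈ D → x = x' := fun x y y' h1 h2 => by
    obtain ⟨q, ha, hb, hq⟩ := hpair _ h1 _ h2
    exact inj q hq _ _ _ ha hb
  refine ⟨⟨g, h, fun x => hi _ _ _ (hh _) (hg x), fun y => hs _ _ _ (hg _) (hh y)⟩,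
    fun z hz => hs _ _ _ (hg _) (hp₀ hz), fun T hT => ?_⟩
  obtain ⟨q, -, hTq, hq⟩ := hD ((fun x => (x, g x)) '' T)
    (by rintro _ ⟨x, -, rfl⟩; exact hg x) (hT.image _)
  exact mono _ _ hTq hq

/-! ### Maps that agree up to a permutation group on finite sets -/

section Agree

variable {A X I : Type*}

/-- On the set `T`, the maps `u` and `v` agree up to an element of `G`. -/
def Agree (G : Subgroup (Equiv.Perm A)) (T : Set X) (u v : X → A) : Prop :=
  ∃ α ∈ G, ∀ x ∈ T, α (u x) = v x

namespace Agree

variable {G : Subgroup (Equiv.Perm A)} {T T' : Set X} {a b c : X → A}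

theorem refl (a : X → A) : Agree G T a a := ⟨1, G.one_mem, fun _ _ => rfl⟩

theorem symm (h : Agree G T a b) : Agree G T b a := by
  obtain ⟨α, hα, h⟩ := h
  exact ⟨α⁻¹, G.inv_mem hα, fun x hx => by rw [← h x hx]; simp⟩

theorem trans (h : Agree G T a b) (h' : Agree G T b c) : Agree G T a c := by
  obtain ⟨α, hα, h⟩ := h
  obtain ⟨β, hβ, h'⟩ := h'
  exact ⟨β * α, G.mul_mem hβ hα, fun x hx => by simp [h x hx, h' x hx]⟩

theorem mono (h : Agree G T a b) (hT : T' ⊆ T) : Agree G T' a b := by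
  obtain ⟨α, hα, h⟩ := h
  exact ⟨α, hα, fun x hx => h x (hT hx)⟩

theorem comp {Z : Type*} {S : Set Z} {k : Z → X} (h : Agree G (k '' S) a b) :
    Agree G S (a ∘ k) (b ∘ k) := by
  obtain ⟨α, hα, h⟩ := h
  exact ⟨α, hα, fun x hx => h _ ⟨x, hx, rfl⟩⟩

theorem congr {a' b' : X → A} (h : Agree G T a b) (ha : ∀ x ∈ T, a x = a' x)
    (hb : ∀ x ∈ T, b x = b' x) : Agree G T a' b' := by
  obtain ⟨α, hα, h⟩ := h
  exact ⟨α, hα, fun x hx => by rw [← ha x hx, ← hb x hx, h x hx]⟩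

theorem left {α : Equiv.Perm A} (hα : α ∈ G) : Agree G T a (α ∘ a) :=
  ⟨α, hα, fun _ _ => rfl⟩

end Agree

/-- `G` has finitely many orbits of `n`-tuples for every `n`, stated by representatives. -/
def Oligomorphic (G : Subgroup (Equiv.Perm A)) : Prop :=
  ∀ n : ℕ, ∃ (J : Type) (_ : Finite J) (c : (Fin n → A) → J),
    ∀ a b, c a = c b → Agree G Set.univ a b

theorem Oligomorphic.exists_coloring {G : Subgroup (Equiv.Perm A)} (hG : Oligomorphic G)
    {T : Set X} (hT : T.Finite) :
    ∃ (J : Type) (_ : Finite J) (c : (X → A) → J), ∀ a b, c a = c b → Agree G T a b := by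
  have := hT.to_subtype
  obtain ⟨n, ⟨e⟩⟩ := Finite.exists_equiv_fin T
  obtain ⟨J, hJ, c, hc⟩ := hG n
  refine ⟨J, hJ, fun a => c (fun i => a (e.symm i)), fun a b hab => ?_⟩
  obtain ⟨α, hα, h⟩ := hc _ _ hab
  exact ⟨α, hα, fun x hx => by simpa using h (e ⟨x, hx⟩) trivial⟩

theorem Oligomorphic.exists_eventually_agree {G : Subgroup (Equiv.Perm A)} (hG : Oligomorphic G)
    (U : Ultrafilter I) (k : I → X → A) {T : Set X} (hT : T.Finite) :
    ∃ p : X → A, ∀ᶠ i in U, Agree G T (k i) p := by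
  obtain ⟨J, hJ, c, hc⟩ := hG.exists_coloring hT
  have : ∃ j, ∀ᶠ i in U, c (k i) = j :=
    Ultrafilter.eventually_exists_iff.1 (Filter.Eventually.of_forall fun i => ⟨_, rfl⟩)
  obtain ⟨j, hj⟩ := this
  obtain ⟨i₀, hi₀⟩ := hj.exists
  refine ⟨k i₀, hj.mono fun i hi => hc _ _ (hi.trans hi₀.symm)⟩

/-- Ultralimits of maps into an oligomorphic permutation group. -/
theorem Oligomorphic.exists_ultralimit {G : Subgroup (Equiv.Perm A)} (hG : Oligomorphic G)
    [Countable X] (U : Ultrafilter I) (k : I → X → A) :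
    ∃ g : X → A, ∀ T : Set X, T.Finite → ∀ᶠ i in U, Agree G T (k i) g := by
  obtain ⟨g, hg⟩ := exists_function_of_forth
    (fun p : Set (X × A) => ∀ᶠ i in U, Agree G p (fun z => k i z.1) (fun z => z.2))
    (fun p q hqp h => h.mono fun i hi => hi.mono hqp)
    (fun p hp h x => by
      obtain ⟨r, hr⟩ := hG.exists_eventually_agree U k
        ((hp.image Prod.fst).insert x)
      obtain ⟨i, ⟨α, hα, h1⟩, ⟨β, hβ, h2⟩⟩ := (h.and hr).exists
      -- `α * β⁻¹` moves `r` onto the values already chosen. It is read off at the single index `i`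
      -- but serves for all later `j`.
      refine ⟨α (β⁻¹ (r x)), (h.and hr).mono ?_⟩
      rintro j ⟨⟨γ, hγ, h3⟩, ⟨δ, hδ, h4⟩⟩
      refine ⟨α * β⁻¹ * δ, G.mul_mem (G.mul_mem hα (G.inv_mem hβ)) hδ, ?_⟩
      rintro z (rfl | hz)
      · simp [h4 x (Set.mem_insert _ _)]
      · have hz' : z.1 ∈ insert x (Prod.fst '' p) := Set.mem_insert_of_mem _ ⟨z, hz, rfl⟩
        rw [← h1 z hz]
        simp [h4 _ hz', ← h2 _ hz'])
    (Filter.Eventually.of_forall fun i => ⟨1, G.one_mem, fun z hz => hz.elim⟩)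
  refine ⟨g, fun T hT => (hg T hT).mono ?_⟩
  rintro i ⟨α, hα, h⟩
  exact ⟨α, hα, fun x hx => h (x, g x) ⟨x, hx, rfl⟩⟩

/-- Some ultrafilter on the finite sets contains the finite sets above any given one. -/
theorem exists_ultrafilter_finset (Z : Type*) :
    ∃ U : Ultrafilter (Finset Z), ∀ T : Set Z, T.Finite → ∀ᶠ F : Finset Z in U, T ⊆ F := by
  classical
  refine ⟨Ultrafilter.of Filter.atTop, fun T hT => Ultrafilter.of_le _ ?_⟩
  filter_upwards [Filter.eventually_ge_atTop hT.toFinset] with F hF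
  intro x hx
  exact hF (hT.mem_toFinset.2 hx)

end Agree

/-! ### Ramsey permutation groups and closed monoids above them -/

section Canonical

variable {A : Type*} {G : Subgroup (Equiv.Perm A)} {E : Set (A → A)}

/-- The Ramsey property of a permutation group: a colouring of the copies of `T` is constant on
the copies of `T` inside some copy of `F`. -/
def Ramsey (G : Subgroup (Equiv.Perm A)) : Prop :=
  ∀ (T F : Set A), T.Finite → F.Finite → ∀ χ : (T → A) → Prop,
    ∃ β ∈ G, ∀ α ∈ G, ∀ α' ∈ G, Set.MapsTo α T F → Set.MapsTo α' T F →
      (χ (fun x => β (α x)) ↔ χ (fun x => β (α' x)))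

/-- A transformation monoid containing `G` that is closed in the topology of pointwise
convergence. -/
structure IsClosedMonoidOver (G : Subgroup (Equiv.Perm A)) (E : Set (A → A)) : Prop where
  perm_mem : ∀ α ∈ G, ⇑α ∈ E
  comp_mem : ∀ f ∈ E, ∀ g ∈ E, f ∘ g ∈ E
  closed : ∀ f : A → A, (∀ T : Set A, T.Finite → ∃ g ∈ E, ∀ x ∈ T, g x = f x) → f ∈ E

theorem IsClosedMonoidOver.mem_of_agree (hE : IsClosedMonoidOver G E) {f : A → A}
    (h : ∀ T : Set A, T.Finite → ∃ g ∈ E, Agree G T g f) : f ∈ E := by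
  refine hE.closed f fun T hT => ?_
  obtain ⟨g, hg, α, hα, h⟩ := h T hT
  exact ⟨α ∘ g, hE.comp_mem _ (hE.perm_mem α hα) _ hg, h⟩

/-! ### Maps all of whose finite images can be recovered -/

/-- No map of `E` moves `T` irreversibly. -/
def Recoverable (E : Set (A → A)) (T : Set A) : Prop :=
  ∀ k ∈ E, ∃ h ∈ E, ∀ x ∈ T, h (k x) = x

theorem Recoverable.mono {T T' : Set A} (h : Recoverable E T) (hT : T' ⊆ T) :
    Recoverable E T' := fun k hk => by
  obtain ⟨m, hm, h⟩ := h k hk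
  exact ⟨m, hm, fun x hx => h x (hT hx)⟩

theorem Recoverable.of_agree {X : Type*} {T : Set X} {u v : X → A} (hE : IsClosedMonoidOver G E)
    (h : Recoverable E (u '' T)) (huv : Agree G T u v) : Recoverable E (v '' T) := by
  obtain ⟨α, hα, huv⟩ := huv
  intro k hk
  obtain ⟨m, hm, h⟩ := h (k ∘ α) (hE.comp_mem _ hk _ (hE.perm_mem α hα))
  refine ⟨α ∘ m, hE.comp_mem _ (hE.perm_mem α hα) _ hm, ?_⟩
  rintro _ ⟨x, hx, rfl⟩
  have := h (u x) ⟨x, hx, rfl⟩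
  simp only [Function.comp_apply, huv x hx] at this ⊢
  rw [this, huv x hx]

/-- Among the finite sets of colours reachable from `k` on `T` by further maps of `E`, take a
minimal one. A further map `m` cannot shrink it, so the colour of `k` itself is still reachable from
`m ∘ k`. -/
theorem exists_recoverable_image (hG : Oligomorphic G) (hE : IsClosedMonoidOver G E)
    {T : Set A} (hT : T.Finite) : ∃ k ∈ E, Recoverable E (k '' T) := by
  obtain ⟨J, hJ, c, hc⟩ := hG.exists_coloring hT
  let R : (A → A) → Set J := fun k => {j | ∃ m ∈ E, c (m ∘ k) = j}
  have hid : (id : A → A) ∈ E := hE.perm_mem 1 G.one_mem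
  obtain ⟨k, hk, hmin⟩ := exists_minimalFor_of_wellFoundedLT (fun k => k ∈ E) R ⟨id, hid⟩
  refine ⟨k, hk, fun m hm => ?_⟩
  have hle : R (m ∘ k) ≤ R k := by
    rintro j ⟨m', hm', h⟩
    exact ⟨m' ∘ m, hE.comp_mem _ hm' _ hm, h⟩
  have hmem : c k ∈ R (m ∘ k) := hmin (hE.comp_mem _ hm _ hk) hle ⟨id, hid, rfl⟩
  obtain ⟨h, hh, heq⟩ := hmem
  obtain ⟨α, hα, hα'⟩ := hc _ _ heq
  refine ⟨α ∘ h, hE.comp_mem _ (hE.perm_mem α hα) _ hh, ?_⟩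
  rintro _ ⟨x, hx, rfl⟩
  exact hα' x hx

theorem exists_forall_recoverable_image [Countable A] (hG : Oligomorphic G)
    (hE : IsClosedMonoidOver G E) :
    ∃ g ∈ E, ∀ T : Set A, T.Finite → Recoverable E (g '' T) := by
  choose k hk hrec using fun F : Finset A => exists_recoverable_image hG hE F.finite_toSet
  obtain ⟨U, hU⟩ := exists_ultrafilter_finset A
  obtain ⟨g, hg⟩ := hG.exists_ultralimit U k
  refine ⟨g, hE.mem_of_agree fun T hT => ?_, fun T hT => ?_⟩
  · obtain ⟨F, hF⟩ := (hg T hT).exists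
    exact ⟨_, hk F, hF⟩
  · obtain ⟨F, hF, hTF⟩ := ((hg T hT).and (hU T hT)).exists
    exact ((hrec F).mono (Set.image_mono hTF)).of_agree hE hF

/-! ### Canonical maps -/

/-- The map `f'` is interpolated by the maps `α ∘ f ∘ β` with `α` and `β` in `G`. -/
def Interpolated (G : Subgroup (Equiv.Perm A)) (f' f : A → A) : Prop :=
  ∀ T : Set A, T.Finite → ∃ β ∈ G, Agree G T (f ∘ β) f'

theorem Interpolated.refl (f : A → A) : Interpolated G f f :=
  fun _ _ => ⟨1, G.one_mem, Agree.refl _⟩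

theorem Interpolated.trans {f g h : A → A} (hfg : Interpolated G f g)
    (hgh : Interpolated G g h) : Interpolated G f h := fun T hT => by
  obtain ⟨β, hβ, h1⟩ := hfg T hT
  obtain ⟨γ, hγ, h2⟩ := hgh (β '' T) (hT.image _)
  exact ⟨γ * β, G.mul_mem hγ hβ, h2.comp.trans h1⟩

/-- The orbit of `f (α t)` is or is not that of `o` for all `α` at once, where `t` is a tuple
enumerating `T`. -/
def ConstantAt (G : Subgroup (Equiv.Perm A)) (f : A → A) (T : Set A) (o : A → A) : Prop :=
  ∀ α ∈ G, ∀ α' ∈ G, Agree G T (f ∘ α) o ↔ Agree G T (f ∘ α') o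

theorem ConstantAt.of_interpolated {f f' : A → A} {T : Set A} {o : A → A} (hT : T.Finite)
    (h : ConstantAt G f T o) (hf : Interpolated G f' f) : ConstantAt G f' T o := by
  intro α hα α' hα'
  obtain ⟨β, hβ, hβ'⟩ := hf (α '' T ∪ α' '' T) ((hT.image _).union (hT.image _))
  have h1 : Agree G T (f ∘ (β * α : Equiv.Perm A)) (f' ∘ α) :=
    (hβ'.mono Set.subset_union_left).comp
  have h2 : Agree G T (f ∘ (β * α' : Equiv.Perm A)) (f' ∘ α') :=
    (hβ'.mono Set.subset_union_right).comp
  have := h _ (G.mul_mem hβ hα) _ (G.mul_mem hβ hα')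
  exact ⟨fun h => h2.symm.trans (this.1 (h1.trans h)),
    fun h => h1.symm.trans (this.2 (h2.trans h))⟩

/-- Colour a copy of `T` by whether `f` sends it to the orbit of `o`. The Ramsey property gives for
each finite `F` some `β F` such that `f ∘ β F` is constant on the copies inside `F`; the ultralimit
over `F` is constant on all copies. -/
theorem exists_constantAt [Countable A] (hG : Oligomorphic G) (hR : Ramsey G) (f : A → A)
    {T : Set A} (hT : T.Finite) (o : A → A) :
    ∃ f', Interpolated G f' f ∧ ConstantAt G f' T o := by
  choose β hβ hconst using fun F : Finset A => hR T F hT F.finite_toSet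
    (fun u => ∃ γ ∈ G, ∀ x : T, γ (f (u x)) = o x)
  obtain ⟨U, hU⟩ := exists_ultrafilter_finset A
  obtain ⟨g, hg⟩ := hG.exists_ultralimit U (fun F => f ∘ β F)
  refine ⟨g, fun S hS => ?_, fun α hα α' hα' => ?_⟩
  · obtain ⟨F, hF⟩ := (hg S hS).exists
    exact ⟨β F, hβ F, hF⟩
  · have hfin : (α '' T ∪ α' '' T).Finite := (hT.image _).union (hT.image _)
    obtain ⟨F, hF, hTF⟩ := ((hg _ hfin).and (hU _ hfin)).exists
    have h1 : Agree G T (f ∘ β F ∘ α) (g ∘ α) := (hF.mono Set.subset_union_left).comp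
    have h2 : Agree G T (f ∘ β F ∘ α') (g ∘ α') := (hF.mono Set.subset_union_right).comp
    have := hconst F α hα α' hα' (fun x hx => hTF (.inl ⟨x, hx, rfl⟩))
      (fun x hx => hTF (.inr ⟨x, hx, rfl⟩))
    simp only [Subtype.forall] at this
    exact ⟨fun h => h2.symm.trans (this.1 (h1.trans h)),
      fun h => h1.symm.trans (this.2 (h2.trans h))⟩

/-- A map is canonical if it induces a map on the orbits of tuples. -/
def Canonical (G : Subgroup (Equiv.Perm A)) (f : A → A) : Prop :=
  ∀ T : Set A, T.Finite → ∀ α ∈ G, Agree G T (f ∘ α) f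

theorem exists_canonical [Countable A] (hG : Oligomorphic G) (hR : Ramsey G) (f : A → A) :
    ∃ f', Interpolated G f' f ∧ Canonical G f' := by
  classical
  -- Two colours test one orbit at a time. Finitely many tests can be done in succession, since
  -- constancy survives interpolation; an ultralimit over finite sets of tests handles all of them.
  let Z := {T : Set A // T.Finite} × (A → A)
  have hfin : ∀ P : Finset Z, ∃ f', Interpolated G f' f ∧ ∀ z ∈ P, ConstantAt G f' z.1.1 z.2 := by
    intro P
    induction P using Finset.induction_on with
    | empty => exact ⟨f, .refl f, by simp⟩
    | insert z P hz ih =>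
      obtain ⟨f', h1, h2⟩ := ih
      obtain ⟨g, h3, h4⟩ := exists_constantAt hG hR f' z.1.2 z.2
      refine ⟨g, h3.trans h1, fun y hy => ?_⟩
      rcases Finset.mem_insert.1 hy with rfl | hy
      · exact h4
      · exact (h2 y hy).of_interpolated y.1.2 h3
  choose k hk hconst using hfin
  obtain ⟨U, hU⟩ := exists_ultrafilter_finset Z
  obtain ⟨g, hg⟩ := hG.exists_ultralimit U k
  refine ⟨g, fun T hT => ?_, fun T hT α hα => ?_⟩
  · obtain ⟨F, hF⟩ := (hg T hT).exists
    obtain ⟨β, hβ, h⟩ := hk F T hT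
    exact ⟨β, hβ, h.trans hF⟩
  · have hS : (T ∪ α '' T).Finite := hT.union (hT.image _)
    -- The limit `g` serves as its own test orbit: `k F` passes the test at the identity, hence at
    -- `α`.
    obtain ⟨F, hF, hz⟩ := ((hg _ hS).and (hU {(⟨T, hT⟩, g)} (Set.finite_singleton _))).exists
    have hc := hconst F (⟨T, hT⟩, g) (hz rfl)
    have h1 : Agree G T (k F) g := hF.mono Set.subset_union_left
    have h2 : Agree G T (k F ∘ α) (g ∘ α) := (hF.mono Set.subset_union_right).comp
    exact h2.symm.trans ((hc α hα 1 G.one_mem).2 h1)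

theorem Canonical.comp_agree {f : A → A} (hf : Canonical G f) {X : Type*} {T : Set X}
    (hT : T.Finite) {u v : X → A} (h : Agree G T u v) : Agree G T (f ∘ u) (f ∘ v) := by
  obtain ⟨α, hα, h⟩ := h
  have := (hf (u '' T) (hT.image _) α hα).comp
  exact this.symm.congr (fun _ _ => rfl) (fun x hx => by simp [h x hx])

theorem Canonical.iterate {f : A → A} (hf : Canonical G f) (n : ℕ) : Canonical G f^[n] := by
  intro T hT α hα
  induction n with
  | zero => exact Agree.symm ⟨α, hα, fun _ _ => rfl⟩
  | succ n ih =>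
    rw [Function.iterate_succ']
    exact hf.comp_agree hT ih

/-- A range-rigid map: it preserves the orbits of the tuples in its range. -/
def RangeRigid (G : Subgroup (Equiv.Perm A)) (f : A → A) : Prop :=
  ∀ T : Set A, T.Finite → Agree G T (f ∘ f) f

/-- On `T` the iterates meet finitely many orbits, so they are eventually periodic up to `G`. The
period depends on `T`, but every period divides `m.factorial` for large `m`, so one sequence of
exponents serves all `T`. -/
theorem Canonical.eventually_agree_iterate_factorial {f : A → A} (hG : Oligomorphic G)
    (hf : Canonical G f) {T : Set A} (hT : T.Finite) :
    ∀ᶠ m : ℕ in Filter.atTop, Agree G T (f^[m.factorial] ∘ f^[m.factorial]) f^[m.factorial] := by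
  obtain ⟨J, hJ, c, hc⟩ := hG.exists_coloring hT
  obtain ⟨i, j, hij, hcij⟩ := Finite.exists_ne_map_eq_of_infinite (fun n : ℕ => c f^[n])
  wlog hlt : i < j generalizing i j
  · exact this j i hij.symm hcij.symm (lt_of_le_of_ne (not_lt.1 hlt) hij.symm)
  have hstep : ∀ n, i ≤ n → Agree G T f^[n + (j - i)] f^[n] := by
    intro n hn
    have := ((hf.iterate (n - i)).comp_agree hT (hc _ _ hcij)).symm
    rw [← Function.iterate_add, ← Function.iterate_add] at this
    convert this using 2 <;> omega
  have hper : ∀ d n, i ≤ n → Agree G T f^[n + (j - i) * d] f^[n] := by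
    intro d n hn
    induction d with
    | zero => exact Agree.refl _
    | succ d ih =>
      refine Agree.trans ?_ ih
      have := hstep (n + (j - i) * d) (by omega)
      rwa [add_assoc] at this
  filter_upwards [Filter.eventually_ge_atTop j] with m hm
  obtain ⟨d, hd⟩ : j - i ∣ m.factorial := Nat.dvd_factorial (by omega) (by omega)
  have := hper d m.factorial ((by omega : i ≤ m).trans (Nat.self_le_factorial m))
  rw [← hd, Function.iterate_add] at this
  exact this

theorem exists_canonical_rangeRigid [Countable A] (hG : Oligomorphic G) (hR : Ramsey G)
    (hE : IsClosedMonoidOver G E) :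
    ∃ f ∈ E, Canonical G f ∧ RangeRigid G f ∧
      ∀ T : Set A, T.Finite → Recoverable E (f '' T) := by
  obtain ⟨g, hgE, hg⟩ := exists_forall_recoverable_image hG hE
  obtain ⟨f, hfg, hf⟩ := exists_canonical hG hR g
  have hfE : f ∈ E := hE.mem_of_agree fun T hT => by
    obtain ⟨β, hβ, h⟩ := hfg T hT
    exact ⟨_, hE.comp_mem _ hgE _ (hE.perm_mem β hβ), h⟩
  have hfr : ∀ T : Set A, T.Finite → Recoverable E (f '' T) := fun T hT => by
    obtain ⟨β, hβ, h⟩ := hfg T hT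
    refine Recoverable.of_agree hE ?_ h
    rw [Set.image_comp]
    exact hg _ (hT.image _)
  have hit : ∀ n, f^[n] ∈ E := fun n => by
    induction n with
    | zero => exact hE.perm_mem 1 G.one_mem
    | succ n ih => rw [Function.iterate_succ]; exact hE.comp_mem _ ih _ hfE
  let U := Filter.hyperfilter ℕ
  have hU : ∀ {p : ℕ → Prop}, (∀ᶠ m in Filter.atTop, p m) → ∀ᶠ m in U, p m := fun h =>
    Nat.hyperfilter_le_atTop h
  obtain ⟨r, hr⟩ := hG.exists_ultralimit U (fun m => f^[m.factorial])
  refine ⟨r, hE.mem_of_agree fun T hT => ?_, fun T hT α hα => ?_, fun T hT => ?_, fun T hT => ?_⟩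
  · obtain ⟨m, hm⟩ := (hr T hT).exists
    exact ⟨_, hit _, hm⟩
  · obtain ⟨m, hm, hm'⟩ := ((hr T hT).and (hr (α '' T) (hT.image _))).exists
    exact hm'.comp.symm.trans ((hf.iterate _ T hT α hα).trans hm)
  · obtain ⟨m, ⟨hm, hm'⟩, hidem⟩ := (((hr T hT).and (hr (r '' T) (hT.image _))).and
      (hU (hf.eventually_agree_iterate_factorial hG hT))).exists
    exact hm'.comp.symm.trans ((((hf.iterate _).comp_agree hT hm).symm.trans hidem).trans hm)
  · obtain ⟨m, hm⟩ := (hr T hT).exists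
    refine Recoverable.of_agree hE ?_ hm
    -- A factorial is positive, so the iterate ends with an application of `f` and its image lies in
    -- the range of `f`.
    obtain ⟨n, hn⟩ := Nat.exists_eq_succ_of_ne_zero (Nat.factorial_ne_zero m)
    rw [hn, Function.iterate_succ', Set.image_comp]
    exact hfr _ (hT.image _)

end Canonical

section Limit

variable {A : Type*} {G : Subgroup (Equiv.Perm A)} {f : A → A} {D : Set A}

/-! ### The homogeneous limit of the range of a range-rigid map -/

/-- `D` is a homogeneous limit of the range of `f`: its tuples lie in orbits of tuples on which
`f` preserves orbits, and it realizes all extensions in such orbits. -/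
structure IsHomogeneousLimit (G : Subgroup (Equiv.Perm A)) (f : A → A) (D : Set A) : Prop where
  agree : ∀ T ⊆ D, T.Finite → Agree G T f id
  exists_extension : ∀ T ⊆ D, T.Finite → ∀ y, Agree G (insert y T) f id →
    ∃ γ ∈ G, (∀ x ∈ T, γ x = x) ∧ γ y ∈ D

theorem RangeRigid.agree_image (hf : RangeRigid G f) {T : Set A} (hT : T.Finite) :
    Agree G (f '' T) f id := by
  obtain ⟨α, hα, h⟩ := hf T hT
  refine ⟨α, hα, ?_⟩
  rintro _ ⟨x, hx, rfl⟩
  exact h x hx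

theorem Canonical.agree_image (hf : Canonical G f) {T : Set A} (hT : T.Finite)
    (h : Agree G T f id) {α : Equiv.Perm A} (hα : α ∈ G) : Agree G (α '' T) f id := by
  obtain ⟨β, hβ, h'⟩ := ((hf T hT α hα).trans h).trans (Agree.left hα)
  refine ⟨β, hβ, ?_⟩
  rintro _ ⟨x, hx, rfl⟩
  exact h' x hx

/-- To realize the extension of `T` by `y` next to `p`, apply `f` to all the points and move the
images of `T ∪ p` back by `α`. The result is good because it is a `G`-translate of a set in the
range of `f`. The point `α (f y)` has the type of `y` over `T` because `f` preserves the orbit of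
`insert y T`. -/
theorem exists_isHomogeneousLimit [Countable A] (hf : Canonical G f) (hr : RangeRigid G f) :
    ∃ D, IsHomogeneousLimit G f D := by
  classical
  obtain ⟨D, -, hD, hC⟩ := exists_generic_set (fun T => Agree G T f id)
    (fun (i : Finset A × A) q => Agree G (i.1 ∪ q) f id → Agree G (insert i.2 i.1) f id →
      ∃ γ ∈ G, (∀ x ∈ i.1, γ x = x) ∧ γ i.2 ∈ q) ∅ Set.finite_empty
    ⟨1, G.one_mem, fun x hx => hx.elim⟩ (by
      rintro ⟨T, y⟩ p hp hPp
      by_cases h1 : Agree G (T ∪ p) f id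
      swap
      · exact ⟨p, subset_rfl, hp, hPp, fun h => (h1 h).elim⟩
      by_cases h2 : Agree G (insert y T) f id
      swap
      · exact ⟨p, subset_rfl, hp, hPp, fun _ h => (h2 h).elim⟩
      have hfin : (insert y (T ∪ p : Set A)).Finite := (T.finite_toSet.union hp).insert _
      obtain ⟨α, hα, h1⟩ := h1
      obtain ⟨β, hβ, h2⟩ := h2
      refine ⟨α '' (f '' insert y (T ∪ p)), fun x hx => ?_, (hfin.image _).image _,
        hf.agree_image (hfin.image _) (hr.agree_image hfin) hα, fun _ _ =>
        ⟨α * β⁻¹, G.mul_mem hα (G.inv_mem hβ), fun x hx => ?_, ?_⟩⟩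
      · exact ⟨f x, ⟨x, .inr (.inr hx), rfl⟩, h1 x (.inr hx)⟩
      · have h3 : β (f x) = x := h2 x (.inr hx)
        have h4 : α (f x) = x := h1 x (.inl hx)
        calc (α * β⁻¹) x = α (β⁻¹ (β (f x))) := by rw [h3]; rfl
          _ = x := by simpa using h4
      · have h3 : β (f y) = y := h2 y (.inl rfl)
        refine ⟨f y, ⟨y, .inl rfl, rfl⟩, ?_⟩
        calc α (f y) = α (β⁻¹ (β (f y))) := by simp
          _ = (α * β⁻¹) y := by rw [h3]; rfl)
  have hDgood : ∀ T ⊆ D, T.Finite → Agree G T f id := fun T hT hTf => by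
    obtain ⟨q, -, hTq, hq⟩ := hD T hT hTf
    exact hq.mono hTq
  refine ⟨D, hDgood, fun T hT hTf y hy => ?_⟩
  obtain ⟨q, hqD, hq, h⟩ := hC (hTf.toFinset, y)
  simp only [Set.Finite.coe_toFinset, Set.Finite.mem_toFinset] at h
  obtain ⟨γ, hγ, h1, h2⟩ := h (hDgood _ (Set.union_subset hT hqD) (hTf.union hq)) hy
  exact ⟨γ, hγ, h1, hqD h2⟩

namespace IsHomogeneousLimit

variable {C : Type*} {ι : C → A}

/-- By range-rigidity, `f` preserves orbits on its own image, so `D` realizes the types of finite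
parts of that image point by point. -/
theorem exists_map_into [Countable A] (hD : IsHomogeneousLimit G f D) (hf : Canonical G f)
    (hr : RangeRigid G f) (hι : Set.range ι = D) :
    ∃ j : A → C, ∀ T : Set A, T.Finite → Agree G T f (ι ∘ j) := by
  subst hι
  obtain ⟨j, hj⟩ := exists_function_of_forth
    (fun p : Set (A × C) => Agree G p (fun z => f z.1) (fun z => ι z.2))
    (fun p q hqp h => h.mono hqp) (fun p hp h x => by
      obtain ⟨α, hα, h⟩ := h
      have hfin : (insert x (Prod.fst '' p)).Finite := (hp.image _).insert _
      have hT : (fun z : A × C => ι z.2) '' p ⊆ Set.range ι := by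
        rintro _ ⟨z, -, rfl⟩
        exact ⟨_, rfl⟩
      obtain ⟨γ, hγ, h1, y, h2⟩ := hD.exists_extension _ hT (hp.image _) (α (f x))
        ((hf.agree_image (hfin.image _) (hr.agree_image hfin) hα).mono (by
          rintro _ (rfl | ⟨z, hz, rfl⟩)
          · exact ⟨_, ⟨x, .inl rfl, rfl⟩, rfl⟩
          · exact ⟨_, ⟨z.1, .inr ⟨z, hz, rfl⟩, rfl⟩, h z hz⟩))
      refine ⟨y, γ * α, G.mul_mem hγ hα, ?_⟩
      rintro z (rfl | hz)
      · exact h2.symm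
      · have := h z hz
        simp only at this
        simp [this, h1 _ ⟨z, hz, rfl⟩])
    ⟨1, G.one_mem, fun z hz => hz.elim⟩
  refine ⟨j, fun T hT => ?_⟩
  obtain ⟨α, hα, h⟩ := hj T hT
  exact ⟨α, hα, fun x hx => h (x, j x) ⟨x, hx, rfl⟩⟩

/-- Partial maps of a homogeneous limit induced by `G` extend by one point. -/
theorem exists_forth (hD : IsHomogeneousLimit G f D) (hf : Canonical G f)
    (hι : Set.range ι = D) {p : Set (C × C)} (hp : p.Finite)
    (h : Agree G p (fun z => ι z.1) (fun z => ι z.2)) (x : C) :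
    ∃ y, Agree G (insert (x, y) p) (fun z => ι z.1) (fun z => ι z.2) := by
  subst hι
  obtain ⟨α, hα, h⟩ := h
  have hfin : (insert (ι x) ((fun z : C × C => ι z.1) '' p)).Finite := (hp.image _).insert _
  have hsub : insert (ι x) ((fun z : C × C => ι z.1) '' p) ⊆ Set.range ι := by
    rintro _ (rfl | ⟨z, -, rfl⟩) <;> exact ⟨_, rfl⟩
  have hT : (fun z : C × C => ι z.2) '' p ⊆ Set.range ι := by
    rintro _ ⟨z, -, rfl⟩
    exact ⟨_, rfl⟩
  obtain ⟨γ, hγ, h1, y, h2⟩ := hD.exists_extension _ hT (hp.image _) (α (ι x))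
    ((hf.agree_image hfin (hD.agree _ hsub hfin) hα).mono (by
      rintro _ (rfl | ⟨z, hz, rfl⟩)
      · exact ⟨_, .inl rfl, rfl⟩
      · exact ⟨_, .inr ⟨z, hz, rfl⟩, h z hz⟩))
  refine ⟨y, γ * α, G.mul_mem hγ hα, ?_⟩
  rintro z (rfl | hz)
  · exact h2.symm
  · have := h z hz
    simp only at this
    simp [this, h1 _ ⟨z, hz, rfl⟩]

end IsHomogeneousLimit

/-- The permutations of `C` that are induced by elements of `G` on every finite set. -/
def locallyInduced (G : Subgroup (Equiv.Perm A)) {C : Type*} (ι : C → A) :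
    Subgroup (Equiv.Perm C) where
  carrier := {σ | ∀ S : Set C, S.Finite → Agree G S ι (ι ∘ σ)}
  one_mem' S _ := Agree.refl _
  mul_mem' {σ τ} hσ hτ S hS := (hτ S hS).trans (hσ (τ '' S) (hS.image _)).comp
  inv_mem' {σ} hσ S hS := by
    have := (hσ ((σ⁻¹ : Equiv.Perm C) '' S) (hS.image _)).comp
    exact this.symm.congr (fun x _ => by simp) fun _ _ => rfl

namespace IsHomogeneousLimit

variable {C : Type*} {ι : C → A}

theorem exists_locallyInduced [Countable C] (hD : IsHomogeneousLimit G f D) (hf : Canonical G f)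
    (hι : Set.range ι = D) (hinj : ι.Injective) {T : Set C} (hT : T.Finite) {v : C → C}
    (h : Agree G T ι (ι ∘ v)) : ∃ σ ∈ locallyInduced G ι, ∀ x ∈ T, σ x = v x := by
  have hcl : ∀ p : Set (C × C), Agree G p (fun z => ι z.1) (fun z => ι z.2) →
      Agree G (Prod.swap '' p) (fun z => ι z.1) (fun z => ι z.2) := by
    rintro p hp
    obtain ⟨α, hα, h⟩ := hp.symm
    refine ⟨α, hα, ?_⟩
    rintro _ ⟨z, hz, rfl⟩
    exact h z hz
  obtain ⟨σ, h1, h2⟩ := exists_equiv_of_back_and_forth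
    (fun p : Set (C × C) => Agree G p (fun z => ι z.1) (fun z => ι z.2))
    (fun p q hqp h => h.mono hqp)
    (fun p ⟨α, hα, h⟩ x y y' hy hy' => hinj ((h _ hy).symm.trans (h _ hy')))
    (fun p ⟨α, hα, h⟩ x x' y hy hy' => hinj (α.injective ((h _ hy).trans (h _ hy').symm)))
    (fun p hp h x => hD.exists_forth hf hι hp h x)
    -- The condition is symmetric in the two coordinates, so back is forth for the swapped relation.
    (fun p hp h y => by
      obtain ⟨x, hx⟩ := hD.exists_forth hf hι (hp.image _) (hcl p h) y
      refine ⟨x, ?_⟩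
      have := hcl _ hx
      rwa [Set.image_insert_eq, ← Set.image_comp, Prod.swap_swap_eq, Set.image_id] at this)
    ((fun x => (x, v x)) '' T) (hT.image _) (by
      obtain ⟨α, hα, h⟩ := h
      refine ⟨α, hα, ?_⟩
      rintro _ ⟨x, hx, rfl⟩
      exact h x hx)
  exact ⟨σ, fun S hS => (h2 S hS).comp, fun x hx => h1 _ ⟨x, hx, rfl⟩⟩

theorem oligomorphic_locallyInduced [Countable C] (hG : Oligomorphic G)
    (hD : IsHomogeneousLimit G f D) (hf : Canonical G f)
    (hι : Set.range ι = D) (hinj : ι.Injective) : Oligomorphic (locallyInduced G ι) := by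
  classical
  intro n
  obtain ⟨J, hJ, c, hc⟩ := hG n
  refine ⟨J, hJ, fun a => c (ι ∘ a), fun a b hab => ?_⟩
  obtain ⟨α, hα, h⟩ := hc _ _ hab
  have h' : ∀ x ∈ Set.range a, ∃ y, α (ι x) = ι y := by
    rintro _ ⟨i, rfl⟩
    exact ⟨b i, h i trivial⟩
  choose! v hv using h'
  obtain ⟨σ, hσ, h2⟩ := hD.exists_locallyInduced hf hι hinj (Set.finite_range a) (v := v)
    ⟨α, hα, hv⟩
  refine ⟨σ, hσ, fun i _ => hinj ?_⟩
  rw [h2 _ ⟨i, rfl⟩, ← hv _ ⟨i, rfl⟩]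
  exact h i trivial

/-- The colouring is pulled back along `j` to copies in `A`. The monochromatic copy returns through
`j ∘ β ∘ ι`, which agrees with `ι` up to `G` on `F` because `f` is canonical and preserves orbits on
`D`; homogeneity of `D` replaces it by some `σ`. -/
theorem ramsey_locallyInduced [Countable A] [Countable C] (hR : Ramsey G)
    (hD : IsHomogeneousLimit G f D) (hf : Canonical G f) (hr : RangeRigid G f)
    (hι : Set.range ι = D) (hinj : ι.Injective) : Ramsey (locallyInduced G ι) := by
  obtain ⟨j, hj⟩ := hD.exists_map_into hf hr hι
  intro T F hT hF χ
  obtain ⟨β, hβ, h⟩ := hR (ι '' T) (ι '' F) (hT.image _) (hF.image _)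
    (fun u => χ (fun x => j (u ⟨ι x, x, x.2, rfl⟩)))
  have h1 : Agree G F ι (ι ∘ (j ∘ β ∘ ι)) := by
    have h2 : Agree G F (f ∘ β ∘ ι) (ι ∘ j ∘ β ∘ ι) := by
      have := (hj (β '' (ι '' F)) ((hF.image _).image _)).comp.comp
      exact this
    have h3 : Agree G F (f ∘ β ∘ ι) (f ∘ ι) := (hf (ι '' F) (hF.image _) β hβ).comp
    have h4 : Agree G F (f ∘ ι) ι :=
      (hD.agree (ι '' F) (by rw [← hι]; exact Set.image_subset_range _ _) (hF.image _)).comp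
    exact (h3.trans h4).symm.trans h2
  obtain ⟨σ, hσ, hσF⟩ := hD.exists_locallyInduced hf hι hinj hF h1
  have hkey : ∀ α ∈ locallyInduced G ι, Set.MapsTo α T F → ∃ α₀ ∈ G,
      Set.MapsTo α₀ (ι '' T) (ι '' F) ∧ ∀ x : T, σ (α x) = j (β (α₀ (ι x))) := by
    intro α hα hm
    obtain ⟨α₀, hα₀, h5⟩ := hα T hT
    refine ⟨α₀, hα₀, ?_, fun x => ?_⟩
    · rintro _ ⟨x, hx, rfl⟩
      exact ⟨α x, hm hx, (h5 x hx).symm⟩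
    · rw [hσF _ (hm x.2), h5 x x.2]
      rfl
  refine ⟨σ, hσ, fun α hα α' hα' hm hm' => ?_⟩
  obtain ⟨α₀, hα₀, hm₀, h6⟩ := hkey α hα hm
  obtain ⟨α₁, hα₁, hm₁, h7⟩ := hkey α' hα' hm'
  simp only [h6, h7]
  exact h α₀ hα₀ α₁ hα₁ hm₀ hm₁

end IsHomogeneousLimit

end Limit

end OrbitAgreement

namespace FirstOrder.Language

open OrbitAgreement

/-! ### Embeddings of relational structures as maps -/

section Embeddings

variable {K : Language.{u, v}} {X Y Z : Type*} [K.Structure X] [K.Structure Y] [K.Structure Z]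

/-- `f` is injective, and preserves and reflects all relations. -/
structure IsEmbeddingMap (K : Language.{u, v}) {X Y : Type*} [K.Structure X] [K.Structure Y]
    (f : X → Y) : Prop where
  injective : f.Injective
  map_rel : ∀ {n : ℕ} (r : K.Relations n) (x : Fin n → X),
    Structure.RelMap r (f ∘ x) ↔ Structure.RelMap r x

theorem Embedding.isEmbeddingMap (e : X ↪[K] Y) : IsEmbeddingMap K e :=
  ⟨e.injective, fun r x => e.map_rel r x⟩

theorem Equiv.isEmbeddingMap (e : X ≃[K] Y) : IsEmbeddingMap K e :=
  ⟨e.injective, fun r x => e.map_rel r x⟩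

namespace IsEmbeddingMap

theorem comp {g : Y → Z} {f : X → Y} (hg : IsEmbeddingMap K g) (hf : IsEmbeddingMap K f) :
    IsEmbeddingMap K (g ∘ f) :=
  ⟨hg.injective.comp hf.injective, fun r x => (hg.map_rel r (f ∘ x)).trans (hf.map_rel r x)⟩

theorem of_comp {g : Y → Z} {f : X → Y} (hg : IsEmbeddingMap K g)
    (h : IsEmbeddingMap K (g ∘ f)) : IsEmbeddingMap K f :=
  ⟨h.injective.of_comp, fun r x => (hg.map_rel r (f ∘ x)).symm.trans (h.map_rel r x)⟩

theorem of_locally {f : X → Y}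
    (h : ∀ T : Set X, T.Finite → ∃ g, IsEmbeddingMap K g ∧ ∀ x ∈ T, g x = f x) :
    IsEmbeddingMap K f := by
  refine ⟨fun x y hxy => ?_, fun r x => ?_⟩
  · obtain ⟨g, hg, h⟩ := h {x, y} (by simp)
    exact hg.injective (by rw [h x (by simp), h y (by simp), hxy])
  · obtain ⟨g, hg, h⟩ := h (Set.range x) (Set.finite_range x)
    have : f ∘ x = g ∘ x := funext fun i => (h _ ⟨i, rfl⟩).symm
    rw [this, hg.map_rel]

theorem symm {σ : X ≃ Y} (h : IsEmbeddingMap K σ) : IsEmbeddingMap K σ.symm :=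
  ⟨σ.symm.injective, fun r x => by rw [← h.map_rel]; simp [← Function.comp_assoc]⟩

/-- An embedding from a map. -/
def toEmbedding [K.IsRelational] {f : X → Y} (h : IsEmbeddingMap K f) : X ↪[K] Y where
  toFun := f
  inj' := h.injective
  map_fun' g := isEmptyElim g
  map_rel' r x := h.map_rel r x

@[simp]
theorem toEmbedding_apply [K.IsRelational] {f : X → Y} (h : IsEmbeddingMap K f) (x : X) :
    h.toEmbedding x = f x := rfl

/-- An isomorphism from a bijection. -/
def toEquiv [K.IsRelational] {σ : X ≃ Y} (h : IsEmbeddingMap K σ) : X ≃[K] Y where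
  toEquiv := σ
  map_fun' g := isEmptyElim g
  map_rel' r x := h.map_rel r x

@[simp]
theorem toEquiv_apply [K.IsRelational] {σ : X ≃ Y} (h : IsEmbeddingMap K σ) (x : X) :
    h.toEquiv x = σ x := rfl

end IsEmbeddingMap

/-- Back-and-forth for structures in which embeddings can be inverted on finite sets. -/
theorem exists_equiv_of_recoverable [K.IsRelational] [Countable X] [Countable Y]
    (hXY : ∀ (g : X ↪[K] Y) (T : Set X), T.Finite → ∃ h : Y ↪[K] X, ∀ x ∈ T, h (g x) = x)
    (hYX : ∀ (h : Y ↪[K] X) (T : Set Y), T.Finite → ∃ g : X ↪[K] Y, ∀ y ∈ T, g (h y) = y)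
    (g₀ : X ↪[K] Y) {T : Set X} (hT : T.Finite) : ∃ e : X ≃[K] Y, ∀ x ∈ T, e x = g₀ x := by
  obtain ⟨e, h1, h2⟩ := exists_equiv_of_back_and_forth
    (fun p : Set (X × Y) => ∃ g : X ↪[K] Y, ∀ z ∈ p, g z.1 = z.2)
    (fun p q hqp ⟨g, hg⟩ => ⟨g, fun z hz => hg z (hqp hz)⟩)
    (fun p ⟨g, hg⟩ x y y' hy hy' => (hg _ hy).symm.trans (hg _ hy'))
    (fun p ⟨g, hg⟩ x x' y hy hy' => g.injective ((hg _ hy).trans (hg _ hy').symm))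
    (fun p hp ⟨g, hg⟩ x => ⟨g x, g, by
      rintro z (rfl | hz)
      exacts [rfl, hg z hz]⟩)
    (fun p hp ⟨g, hg⟩ y => by
      -- `h` undoes `g` on the domain of `p`, and `g'` undoes `h` on the range of `p` and `y`. So
      -- `g'` still extends `p` and takes `h y` to `y`.
      obtain ⟨h, hh⟩ := hXY g (Prod.fst '' p) (hp.image _)
      obtain ⟨g', hg'⟩ := hYX h (insert y (Prod.snd '' p)) ((hp.image _).insert _)
      refine ⟨h y, g', ?_⟩
      rintro z (rfl | hz)
      · exact hg' _ (.inl rfl)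
      · have h3 := hg' z.2 (.inr ⟨z, hz, rfl⟩)
        rwa [← hg z hz, hh _ ⟨z, hz, rfl⟩, hg z hz] at h3)
    ((fun x => (x, g₀ x)) '' T) (hT.image _) ⟨g₀, by rintro _ ⟨x, -, rfl⟩; rfl⟩
  have he : IsEmbeddingMap K e := .of_locally fun S hS => by
    obtain ⟨g, hg⟩ := h2 S hS
    exact ⟨g, g.isEmbeddingMap, fun x hx => hg _ ⟨x, hx, rfl⟩⟩
  exact ⟨he.toEquiv, fun x hx => h1 _ ⟨x, hx, rfl⟩⟩

/-- Composing `g` with an embedding `k` back into `X` gives a self-embedding, which an automorphism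
`α` matches on `T`; then `α⁻¹ ∘ k` undoes `g` there. -/
theorem IsModelComplete.exists_inverse {X : Type w} {Y : Type w'} [K.Structure X]
    [K.Structure Y] (hX : K.IsModelComplete X) (h : Nonempty (Y ↪[K] X)) (g : X ↪[K] Y)
    (T : Set X) (hT : T.Finite) : ∃ h : Y ↪[K] X, ∀ x ∈ T, h (g x) = x := by
  obtain ⟨k⟩ := h
  obtain ⟨α, hα⟩ := hX.dense (k.comp g) hT.toFinset
  refine ⟨α.symm.toEmbedding.comp k, fun x hx => ?_⟩
  have := hα x (by simpa using hx)
  simp only [Embedding.comp_apply] at this ⊢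
  rw [← this]
  exact α.symm_apply_apply x

/-- Model-companions are unique up to isomorphism. -/
theorem IsModelCompanion.nonempty_equiv [K.IsRelational] {A : Type*} [K.Structure A]
    {X : Type w} {Y : Type w'} [K.Structure X] [K.Structure Y]
    (hX : K.IsModelCompanion X A) (hY : K.IsModelCompanion Y A) : Nonempty (X ≃[K] Y) := by
  have := hX.isModelComplete.countable
  have := hY.isModelComplete.countable
  obtain ⟨a⟩ := hX.embeds_into
  obtain ⟨b⟩ := hX.embeds_from
  obtain ⟨c⟩ := hY.embeds_into
  obtain ⟨d⟩ := hY.embeds_from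
  obtain ⟨e, -⟩ := exists_equiv_of_recoverable
    (hX.isModelComplete.exists_inverse ⟨a.comp d⟩) (hY.isModelComplete.exists_inverse ⟨c.comp b⟩)
    (c.comp b) Set.finite_empty
  exact ⟨e⟩

end Embeddings

/-! ### Automorphism groups -/

section AutGroup

variable (K : Language.{u, v}) {A : Type w} [K.Structure A]

/-- The automorphism group of a relational structure, as a permutation group. -/
def autGroup (A : Type w) [K.Structure A] : Subgroup (Equiv.Perm A) where
  carrier := {σ | IsEmbeddingMap K σ}
  one_mem' := ⟨Function.injective_id, fun _ _ => Iff.rfl⟩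
  mul_mem' hσ hτ := hσ.comp hτ
  inv_mem' hσ := hσ.symm

variable {K}

theorem Equiv.mem_autGroup (α : A ≃[K] A) : α.toEquiv ∈ K.autGroup A := α.isEmbeddingMap

theorem IsOmegaCategorical.oligomorphic (h : K.IsOmegaCategorical A) :
    Oligomorphic (K.autGroup A) := by
  intro n
  rcases Nat.eq_zero_or_pos n with rfl | hn
  · exact ⟨Unit, inferInstance, fun _ => (), fun a b _ => ⟨1, one_mem _, fun i => i.elim0⟩⟩
  · have := h n hn
    obtain ⟨m, ⟨e⟩⟩ := Finite.exists_equiv_fin (Quotient (K.orbitSetoid A n))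
    refine ⟨Fin m, inferInstance, fun a => e (Quotient.mk _ a), fun a b hab => ?_⟩
    obtain ⟨α, hα⟩ := Quotient.exact (e.injective hab)
    exact ⟨α.toEquiv, α.mem_autGroup, fun i _ => hα i⟩

theorem isOmegaCategorical_of_oligomorphic [K.IsRelational] {G : Subgroup (Equiv.Perm A)}
    (hG : Oligomorphic G) (hle : G ≤ K.autGroup A) : K.IsOmegaCategorical A := by
  intro n _
  obtain ⟨J, hJ, c, hc⟩ := hG n
  refine Finite.of_injective (fun q : Quotient (K.orbitSetoid A n) => c q.out) fun p q h => ?_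
  obtain ⟨α, hα, h'⟩ := hc _ _ h
  rw [← p.out_eq, ← q.out_eq]
  exact Quotient.sound ⟨IsEmbeddingMap.toEquiv (hle hα), fun i => h' i trivial⟩

/-- Every isomorphism between finite substructures is induced by an automorphism. -/
theorem IsUltrahomogeneous.exists_autGroup [K.IsRelational] (h : K.IsUltrahomogeneous A)
    {S : Type*} [K.Structure S] [Finite S] {s t : S → A} (hs : IsEmbeddingMap K s)
    (ht : IsEmbeddingMap K t) : ∃ α ∈ K.autGroup A, ∀ x, α (s x) = t x := by
  let s' := hs.toEmbedding
  let t' := ht.toEmbedding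
  obtain ⟨α, hα⟩ := h s'.toHom.range (Structure.FG.range Structure.FG.of_finite s'.toHom)
    (t'.comp s'.equivRange.symm.toEmbedding)
  refine ⟨α.toEquiv, α.mem_autGroup, fun x => ?_⟩
  have := DFunLike.congr_fun hα (s'.equivRange x)
  simp only [Embedding.comp_apply, Equiv.coe_toEmbedding, Equiv.symm_apply_apply] at this
  exact this.symm

/-- By homogeneity the orbit of a tuple is determined by its equalities and relations, and a finite
signature allows finitely many such patterns. -/
theorem oligomorphic_of_finite_symbols [K.IsRelational] [Finite K.Symbols]
    (h : K.IsUltrahomogeneous A) : Oligomorphic (K.autGroup A) := by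
  classical
  intro n
  have : Finite (Σ l, K.Relations l) :=
    Finite.of_injective (fun r => (Sum.inr r : K.Symbols)) Sum.inr_injective
  obtain ⟨m, ⟨e⟩⟩ := Finite.exists_equiv_fin
    ((Fin n → Fin n → Prop) × ((r : Σ l, K.Relations l) → (Fin r.1 → Fin n) → Prop))
  refine ⟨Fin m, inferInstance, fun a => e (fun i j => a i = a j,
    fun r t => Structure.RelMap r.2 (a ∘ t)), fun a b hab => ?_⟩
  have hab := e.injective hab
  simp only [Prod.mk.injEq] at hab
  obtain ⟨h1, h2⟩ := hab
  have h1 : ∀ i j, a i = a j ↔ b i = b j := fun i j => by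
    simpa using congr_fun (congr_fun h1 i) j
  let S : K.Substructure A := ⟨Set.range a, fun f => isEmptyElim f⟩
  have : Finite S := (Set.finite_range a).to_subtype
  have hS : ∀ x : S, ∃ i, a i = x := fun x => x.2
  choose i hi using hS
  obtain ⟨α, hα, h3⟩ := h.exists_autGroup (s := S.subtype) (t := b ∘ i)
    S.subtype.isEmbeddingMap ⟨fun x y hxy => Subtype.ext (by
      rw [← hi x, ← hi y]
      exact (h1 _ _).2 hxy), fun {l} r x => by
      have := congr_fun (congr_fun h2 ⟨l, r⟩) (i ∘ x)
      simp only [eq_iff_iff] at this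
      have hx : a ∘ i ∘ x = S.subtype ∘ x := funext fun k => hi (x k)
      rw [hx] at this
      exact this.symm.trans (S.subtype.isEmbeddingMap.map_rel r x)⟩
  refine ⟨α, hα, fun j _ => ?_⟩
  have h4 := h3 ⟨a j, j, rfl⟩
  refine h4.trans ?_
  exact (h1 _ _).1 (hi ⟨a j, j, rfl⟩)

theorem IsRamsey.ramsey_autGroup [K.IsRelational] (hU : K.IsUltrahomogeneous A)
    (hR : K.IsRamsey A) : Ramsey (K.autGroup A) := by
  classical
  intro T F hT hF χ
  let S : K.Substructure A := ⟨T, fun f => isEmptyElim f⟩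
  let R : K.Substructure A := ⟨F, fun f => isEmptyElim f⟩
  have : Finite S := hT.to_subtype
  have : Finite R := hF.to_subtype
  obtain ⟨e, c, hc⟩ := hR ⟨S, inferInstance⟩ ⟨Structure.FG.of_finite, ⟨S.subtype⟩⟩
    ⟨R, inferInstance⟩ ⟨Structure.FG.of_finite, ⟨R.subtype⟩⟩
    (fun e => decide (χ (fun x => e (⟨x.1, x.2⟩ : S))))
  obtain ⟨β, hβ, h⟩ := hU.exists_autGroup R.subtype.isEmbeddingMap
    (Embedding.isEmbeddingMap (X := R) e)
  have key : ∀ α ∈ K.autGroup A, Set.MapsTo α T F →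
      decide (χ (fun x : T => β (α x))) = c := by
    intro α hα hm
    have hk : IsEmbeddingMap K (fun x : S => (⟨α x, hm x.2⟩ : R)) :=
      .of_comp R.subtype.isEmbeddingMap
        (IsEmbeddingMap.comp hα S.subtype.isEmbeddingMap : IsEmbeddingMap K (α ∘ S.subtype))
    rw [← hc hk.toEmbedding]
    congr 2
    funext x
    exact h ⟨α x, hm x.2⟩
  refine ⟨β, hβ, fun α hα α' hα' hm hm' => ?_⟩
  exact decide_eq_decide.1 ((key α hα hm).trans (key α' hα' hm').symm)

theorem isRamsey_of_ramsey_autGroup [K.IsRelational] (hU : K.IsUltrahomogeneous A)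
    (hR : Ramsey (K.autGroup A)) : K.IsRamsey A := by
  classical
  rintro ⟨S, instS⟩ ⟨hSfg, ⟨s⟩⟩ ⟨F, instF⟩ ⟨hFfg, ⟨t⟩⟩ χ
  change S ↪[K] A at s
  change F ↪[K] A at t
  have : Finite S := Structure.FG.finite hSfg
  have : Finite F := Structure.FG.finite hFfg
  obtain ⟨β, hβ, h⟩ := hR (Set.range s) (Set.range t) (Set.finite_range s) (Set.finite_range t)
    -- The colouring must be defined on all maps; those that are not embeddings count as false.
    (fun u => ∃ k : S ↪[K] A, (∀ y, k y = u ⟨s y, y, rfl⟩) ∧ χ k = true)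
  let e : F ↪[K] A := (IsEmbeddingMap.comp hβ t.isEmbeddingMap).toEmbedding
  have key : ∀ k : S ↪[K] F, ∃ α ∈ K.autGroup A, Set.MapsTo α (Set.range s) (Set.range t) ∧
      ((∃ k : S ↪[K] A, (∀ y, k y = β (α (s y))) ∧ χ k = true) ↔ χ (e.comp k) = true) := by
    intro k
    obtain ⟨α, hα, h'⟩ := hU.exists_autGroup s.isEmbeddingMap
      (t.isEmbeddingMap.comp k.isEmbeddingMap)
    refine ⟨α, hα, ?_, ?_⟩
    · rintro _ ⟨y, rfl⟩
      exact ⟨k y, (h' y).symm⟩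
    · constructor
      · rintro ⟨k', h1, h2⟩
        have : k' = e.comp k := Embedding.ext fun y => by rw [h1, h' y]; rfl
        rwa [← this]
      · exact fun h2 => ⟨e.comp k, fun y => by rw [h' y]; rfl, h2⟩
  have heq : ∀ k k' : S ↪[K] F, χ (e.comp k) = χ (e.comp k') := by
    intro k k'
    obtain ⟨α, hα, hm, h1⟩ := key k
    obtain ⟨α', hα', hm', h2⟩ := key k'
    exact Bool.eq_iff_iff.2 (h1.symm.trans ((h α hα α' hα' hm hm').trans h2))
  by_cases hk : Nonempty (S ↪[K] F)
  · obtain ⟨k⟩ := hk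
    exact ⟨e, χ (e.comp k), fun k' => heq k' k⟩
  · exact ⟨e, true, fun k => (hk ⟨k⟩).elim⟩

end AutGroup

/-! ### Structures embedded as homogeneous limits -/

section Limit

variable {K : Language.{u, v}} {A : Type w} [K.Structure A] {C : Type w'} [K.Structure C]
  {ι : C → A} {f : A → A} {D : Set A}

/-- An automorphism of `C`, restricted to a finite set, is an isomorphism between finite
substructures of `A`, hence induced by the homogeneity of `A`. Conversely, local agreement with
embeddings suffices to preserve relations. -/
theorem locallyInduced_autGroup [K.IsRelational] (hU : K.IsUltrahomogeneous A)
    (hι : IsEmbeddingMap K ι) : locallyInduced (K.autGroup A) ι = K.autGroup C := by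
  ext σ
  constructor
  · intro hσ
    refine .of_comp hι (.of_locally fun T hT => ?_)
    obtain ⟨α, hα, h⟩ := hσ T hT
    exact ⟨α ∘ ι, IsEmbeddingMap.comp hα hι, h⟩
  · intro hσ S hS
    let S' : K.Substructure C := ⟨S, fun f => isEmptyElim f⟩
    have : Finite S' := hS.to_subtype
    obtain ⟨α, hα, h⟩ := hU.exists_autGroup (hι.comp S'.subtype.isEmbeddingMap)
      ((hι.comp hσ).comp S'.subtype.isEmbeddingMap)
    exact ⟨α, hα, fun x hx => h ⟨x, hx⟩⟩

theorem isUltrahomogeneous_of_isHomogeneousLimit [K.IsRelational] [Countable C]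
    (hU : K.IsUltrahomogeneous A) (hι : IsEmbeddingMap K ι)
    (hD : IsHomogeneousLimit (K.autGroup A) f D) (hf : Canonical (K.autGroup A) f)
    (hrange : Set.range ι = D) : K.IsUltrahomogeneous C := by
  classical
  intro S hS g
  have hfin : Finite S := hS.finite
  obtain ⟨α, hα, h⟩ := hU.exists_autGroup (hι.comp S.subtype.isEmbeddingMap)
    (hι.comp g.isEmbeddingMap)
  obtain ⟨σ, hσ, h'⟩ := hD.exists_locallyInduced hf hrange hι.injective (T := (S : Set C))
    -- The value outside `S` is immaterial.
    hfin (v := fun x => if hx : x ∈ S then g ⟨x, hx⟩ else x)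
    ⟨α, hα, fun x hx => by
      have hx : x ∈ S := hx
      simpa [hx] using h ⟨x, hx⟩⟩
  rw [locallyInduced_autGroup hU hι] at hσ
  refine ⟨IsEmbeddingMap.toEquiv hσ, Embedding.ext fun x => ?_⟩
  have h2 : σ x = g x := by simpa using h' x x.2
  exact h2.symm

theorem isRamsey_of_isHomogeneousLimit [K.IsRelational] [Countable A] [Countable C]
    (hU : K.IsUltrahomogeneous A) (hR : K.IsRamsey A) (hι : IsEmbeddingMap K ι)
    (hD : IsHomogeneousLimit (K.autGroup A) f D) (hf : Canonical (K.autGroup A) f)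
    (hr : RangeRigid (K.autGroup A) f) (hrange : Set.range ι = D) : K.IsRamsey C := by
  refine isRamsey_of_ramsey_autGroup
    (isUltrahomogeneous_of_isHomogeneousLimit hU hι hD hf hrange) ?_
  rw [← locallyInduced_autGroup hU hι]
  exact hD.ramsey_locallyInduced (hR.ramsey_autGroup hU) hf hr hrange hι.injective

end Limit

/-! ### Model-companions from homogeneous limits -/

section Companion

variable {L : Language.{u, v}} {L' : Language.{u', v'}}

theorem IsEmbeddingMap.sum_left {X Y : Type*} [L.Structure X] [L'.Structure X] [L.Structure Y]
    [L'.Structure Y] {f : X → Y} (h : IsEmbeddingMap (L.sum L') f) : IsEmbeddingMap L f :=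
  ⟨h.injective, fun r x => h.map_rel (Sum.inl r) x⟩

theorem IsEmbeddingMap.sum {X Y : Type*} [L.Structure X] [L'.Structure X] [L.Structure Y]
    [L'.Structure Y] {f : X → Y} (h : IsEmbeddingMap L f) (h' : IsEmbeddingMap L' f) :
    IsEmbeddingMap (L.sum L') f :=
  ⟨h.injective, fun r x => by
    rcases r with r | r
    exacts [h.map_rel r x, h'.map_rel r x]⟩

/-- The structure pulled back along a map. -/
@[reducible]
def pullbackStructure (K : Language.{u, v}) [K.IsRelational] {X Y : Type*} [K.Structure Y]
    (f : X → Y) : K.Structure X where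
  funMap g := isEmptyElim g
  RelMap r x := Structure.RelMap r (f ∘ x)

theorem isEmbeddingMap_pullback (K : Language.{u, v}) [K.IsRelational] {X Y : Type*}
    [K.Structure Y] {f : X → Y} (hf : f.Injective) :
    @IsEmbeddingMap K X Y (pullbackStructure K f) _ f :=
  letI := pullbackStructure K f
  ⟨hf, fun _ _ => Iff.rfl⟩

variable {A : Type w} [L.Structure A] [L'.Structure A]

variable (L A) in
/-- The maps that are self-embeddings of `A`. -/
def selfEmbeddings : Set (A → A) := {g | IsEmbeddingMap L g}

variable (L L' A) in
theorem isClosedMonoidOver_selfEmbeddings :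
    IsClosedMonoidOver ((L.sum L').autGroup A) (selfEmbeddings L A) where
  perm_mem _ hα := IsEmbeddingMap.sum_left hα
  comp_mem _ hf _ hg := IsEmbeddingMap.comp hf hg
  closed _ h := .of_locally h

variable [L.IsRelational] [L'.IsRelational] {C : Type w'} [L.Structure C] [L'.Structure C]
  {ι : C → A} {f : A → A} {D : Set A}

theorem isModelCompanion_of_isHomogeneousLimit [Countable A] [Countable C]
    (hG : Oligomorphic ((L.sum L').autGroup A))
    (hU : (L.sum L').IsUltrahomogeneous A) (hι : IsEmbeddingMap (L.sum L') ι)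
    (hD : IsHomogeneousLimit ((L.sum L').autGroup A) f D)
    (hf : Canonical ((L.sum L').autGroup A) f) (hr : RangeRigid ((L.sum L').autGroup A) f)
    (hrange : Set.range ι = D) (hfE : f ∈ selfEmbeddings L A)
    (hrec : ∀ T : Set A, T.Finite → Recoverable (selfEmbeddings L A) (f '' T)) :
    L.IsModelCompanion C A := by
  have hE := isClosedMonoidOver_selfEmbeddings L L' A
  obtain ⟨j, hj⟩ := hD.exists_map_into hf hr hrange
  have hιL := hι.sum_left
  have hjL : IsEmbeddingMap L j := .of_comp hιL
    (hE.mem_of_agree fun T hT => ⟨f, hfE, hj T hT⟩)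
  have hinv : ∀ (e : C ↪[L] C) (T : Set C), T.Finite → ∃ h : C ↪[L] C, ∀ x ∈ T, h (e x) = x := by
    intro e T hT
    have h1 : Agree ((L.sum L').autGroup A) T (f ∘ ι) ι :=
      (hD.agree (ι '' T) (by rw [← hrange]; exact Set.image_subset_range _ _) (hT.image _)).comp
    have h2 : Agree ((L.sum L').autGroup A) T (f ∘ ι) (ι ∘ j ∘ ι) := (hj _ (hT.image ι)).comp
    -- `σ` corrects `j`, so that `σ.symm ∘ j` is a retraction for `ι` on `T`. This turns `e` into a
    -- self-embedding of `A`, to which recoverability applies.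
    obtain ⟨σ, hσ, hσT⟩ := hD.exists_locallyInduced hf hrange hι.injective hT (h1.symm.trans h2)
    rw [locallyInduced_autGroup hU hι] at hσ
    have hσL : IsEmbeddingMap L σ.symm := (IsEmbeddingMap.sum_left hσ).symm
    have hT' : Recoverable (selfEmbeddings L A) (ι '' T) := by
      refine Recoverable.of_agree hE ?_ h1
      rw [Set.image_comp]
      exact hrec _ (hT.image _)
    obtain ⟨h, hh, heq⟩ := hT' (ι ∘ e ∘ σ.symm ∘ j)
      (hιL.comp (e.isEmbeddingMap.comp (hσL.comp hjL)))
    refine ⟨(hσL.comp (hjL.comp (IsEmbeddingMap.comp hh hιL))).toEmbedding, fun x hx => ?_⟩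
    have h3 : σ.symm (j (ι x)) = x := by
      rw [Equiv.symm_apply_eq]
      exact (hσT x hx).symm
    have h4 := heq (ι x) ⟨x, hx, rfl⟩
    simp only [Function.comp_apply, h3] at h4
    simp [h4, h3]
  refine ⟨⟨inferInstance, ?_, fun e s => ?_⟩, ⟨hjL.toEmbedding⟩, ⟨hιL.toEmbedding⟩⟩
  · refine isOmegaCategorical_of_oligomorphic
      (hD.oligomorphic_locallyInduced hG hf hrange hι.injective) ?_
    rw [locallyInduced_autGroup hU hι]
    exact fun σ hσ => IsEmbeddingMap.sum_left hσ
  · obtain ⟨α, hα⟩ := exists_equiv_of_recoverable hinv hinv e s.finite_toSet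
    exact ⟨α, hα⟩

/-- The model-companion and the expansion of any model-companion, constructed from an oligomorphic
homogeneous Ramsey expansion. -/
theorem exists_isModelCompanion_and_expansion [Countable A]
    (hG : Oligomorphic ((L.sum L').autGroup A)) (hU : (L.sum L').IsUltrahomogeneous A)
    (hR : (L.sum L').IsRamsey A) :
    (∃ (A' : Type w) (_ : L.Structure A'), L.IsModelCompanion A' A) ∧
      ∀ (A' : Type w') [L.Structure A'], L.IsModelCompanion A' A → ∃ _ : L'.Structure A',
        (L.sum L').IsOmegaCategorical A' ∧ (L.sum L').IsUltrahomogeneous A' ∧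
          (L.sum L').IsRamsey A' := by
  obtain ⟨f, hfE, hf, hr, hrec⟩ := exists_canonical_rangeRigid hG (hR.ramsey_autGroup hU)
    (isClosedMonoidOver_selfEmbeddings L L' A)
  obtain ⟨D, hD⟩ := exists_isHomogeneousLimit hf hr
  let _ : L.Structure D := pullbackStructure L Subtype.val
  let _ : L'.Structure D := pullbackStructure L' Subtype.val
  have hL : IsEmbeddingMap L (Subtype.val : D → A) :=
    isEmbeddingMap_pullback L Subtype.val_injective
  have hι : IsEmbeddingMap (L.sum L') (Subtype.val : D → A) :=
    hL.sum (isEmbeddingMap_pullback L' Subtype.val_injective)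
  have hcomp : L.IsModelCompanion D A :=
    isModelCompanion_of_isHomogeneousLimit hG hU hι hD hf hr Subtype.range_coe hfE hrec
  refine ⟨⟨D, _, hcomp⟩, fun A' _ hA' => ?_⟩
  have := hA'.isModelComplete.countable
  obtain ⟨φ⟩ := hA'.nonempty_equiv hcomp
  have hφ : IsEmbeddingMap L (Subtype.val ∘ φ : A' → A) := hL.comp φ.isEmbeddingMap
  -- `A'` is another parametrization of `D`, possibly in another universe; the limit lemmas apply to
  -- it because they are stated for any injection `ι` with range `D`.
  let _ : L'.Structure A' := pullbackStructure L' (Subtype.val ∘ φ)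
  have hι' : IsEmbeddingMap (L.sum L') (Subtype.val ∘ φ : A' → A) :=
    hφ.sum (isEmbeddingMap_pullback L' hφ.injective)
  have hrange : Set.range (Subtype.val ∘ φ : A' → A) = D := by
    rw [φ.surjective.range_comp, Subtype.range_coe]
  refine ⟨inferInstance, ?_, isUltrahomogeneous_of_isHomogeneousLimit hU hι' hD hf hrange,
    isRamsey_of_isHomogeneousLimit hU hR hι' hD hf hr hrange⟩
  exact isOmegaCategorical_of_oligomorphic
    (hD.oligomorphic_locallyInduced hG hf hrange hι'.injective)
    (locallyInduced_autGroup hU hι').le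

end Companion

end FirstOrder.Language

theorem mainTheorem2 (L : FirstOrder.Language.{u, v}) [L.IsRelational]
    (A : Type w) [L.Structure A] [Countable A] (hA : L.IsOmegaCategorical A) :
    (FirstOrder.Language.HasOmegaCategoricalHomogeneousRamseyExpansion.{u, v, u', v', w} L A →
      (∃ (A' : Type w) (_ : L.Structure A'), L.IsModelCompanion A' A) ∧
      ∀ (A' : Type w') [L.Structure A'], L.IsModelCompanion A' A →
        FirstOrder.Language.HasOmegaCategoricalHomogeneousRamseyExpansion.{u, v, u', v', w'} L A') ∧
    (FirstOrder.Language.HasFiniteSignatureHomogeneousRamseyExpansion.{u, v, u', v', w} L A →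
      (∃ (A' : Type w) (_ : L.Structure A'), L.IsModelCompanion A' A) ∧
      ∀ (A' : Type w') [L.Structure A'], L.IsModelCompanion A' A →
        FirstOrder.Language.HasFiniteSignatureHomogeneousRamseyExpansion.{u, v, u', v', w'} L A') := by
  refine ⟨?_, ?_⟩
  · rintro ⟨L', hL', _, hω, hU, hR⟩
    obtain ⟨hex, hexp⟩ := FirstOrder.Language.exists_isModelCompanion_and_expansion.{u, v, u', v', w, w'}
      hω.oligomorphic hU hR
    refine ⟨hex, fun A' _ hA' => ?_⟩
    obtain ⟨inst, h⟩ := hexp A' hA'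
    exact ⟨L', hL', inst, h⟩
  · rintro ⟨L', hL', _, hfin, hU, hR⟩
    -- Only the source of oligomorphicity differs from the first part; `L'` is kept, so its
    -- finiteness carries over.
    obtain ⟨hex, hexp⟩ := FirstOrder.Language.exists_isModelCompanion_and_expansion.{u, v, u', v', w, w'}
      (FirstOrder.Language.oligomorphic_of_finite_symbols hU) hU hR
    refine ⟨hex, fun A' _ hA' => ?_⟩
    obtain ⟨inst, -, h⟩ := hexp A' hA'
    exact ⟨L', hL', inst, hfin, h⟩
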